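/- Conventions. Let $\Phi_0,\Phi_1,\dots$ be an effective enumeration of the Turing functionals. For $Z\subseteq\mathbb{N}$ let $W_e^Z$ be the set of finite binary strings (coded as integers) on which $\Phi_e^Z$ halts; a string $\rho$ is identified with the finite set $\{n<|\rho| : \rho(n)=1\}$, and $$\mathcal{U}_e^Z=\{X\subseteq\mathbb{N} : \exists \rho\in W_e^Z\ \ \rho\subseteq X\}.$$ A Turing ideal is a non-empty family $\mathcal{M}\subseteq\mathcal{P}(\mathbb{N})$ that is closed downward under Turing reducibility and closed under the join $X\oplus Y=\{2n:n\in X\}\cup\{2n+1:n\in Y\}$. If $\mathcal{M}=\{Z_0,Z_1,\dots\}$ is a countable Turing ideal with a fixed enumeration and $C\subseteq\mathbb{N}^2$, let $\mathcal{U}_C^{\mathcal{M}}=\bigcap_{(e,i)\in C}\mathcal{U}_e^{Z_i}$. A class $\mathcal{A}\subseteq\mathcal{P}(\mathbb{N})$ is large if it is closed under supersets and, for every $k$ and every cover $Y_1\cup\dots\cup Y_k=\mathbb{N}$, some $Y_i$ belongs to $\mathcal{A}$. For $X\subseteq\mathbb{N}$ let $\mathcal{L}_X$ be the class of all sets having an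 infinite intersection with $X$. A large class $\mathcal{A}$ is $\mathcal{M}$-cohesive if for every $X\in\mathcal{M}$, either $\mathcal{A}\subseteq\mathcal{L}_X$ or $\mathcal{A}\subseteq\mathcal{L}_{\overline{X}}$. A large class $\mathcal{A}$ is $\mathcal{M}$-minimal if for every $X\in\mathcal{M}$ and $e\in\mathbb{N}$, either $\mathcal{A}\subseteq\mathcal{U}_e^X$ or $\mathcal{A}\cap\mathcal{U}_e^X$ is not large. Proposition. For every countable Turing ideal $\mathcal{M}=\{Z_0,Z_1,\dots\}$ (with any enumeration of its elements) there is a set $C\subseteq\mathbb{N}^2$ such that the class $\mathcal{U}_C^{\mathcal{M}}$ is $\mathcal{M}$-cohesive but not $\mathcal{M}$-minimal. -/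

import Mathlib

namespace Largeness

/-- The characteristic function of a set of natural numbers, as a (total) oracle. -/
noncomputable def charFun (Z : Set ℕ) : ℕ →. ℕ := by
  classical exact fun n => Part.some (if n ∈ Z then 1 else 0)

/-- Turing reducibility `Y ≤_T X` between sets of natural numbers. -/
def SetTuringReducible (Y X : Set ℕ) : Prop := TuringReducible (charFun Y) (charFun X)

/-- The effective join `X ⊕ Y = {2n : n ∈ X} ∪ {2n+1 : n ∈ Y}`. -/
def join (X Y : Set ℕ) : Set ℕ := (fun n => 2 * n) '' X ∪ (fun n => 2 * n + 1) '' Y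

/-- Turing ideals: non-empty families of sets closed downward under Turing reduction and closed
under the effective join. -/
structure IsTuringIdeal (M : Set (Set ℕ)) : Prop where
  nonempty : M.Nonempty
  downward : ∀ X ∈ M, ∀ Y : Set ℕ, SetTuringReducible Y X → Y ∈ M
  join_mem : ∀ X ∈ M, ∀ Y ∈ M, join X Y ∈ M

/-- Programs with an oracle; one constructor for each clause of `Nat.RecursiveIn`. -/
inductive OracleCode : Type
  | zero : OracleCode
  | succ : OracleCode
  | left : OracleCode
  | right : OracleCode
  | oracle : OracleCode
  | pair : OracleCode → OracleCode → OracleCode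
  | comp : OracleCode → OracleCode → OracleCode
  | prec : OracleCode → OracleCode → OracleCode
  | rfind : OracleCode → OracleCode

/-- The partial function computed by a program with oracle `g`. -/
def OracleCode.eval (g : ℕ →. ℕ) : OracleCode → ℕ →. ℕ
  | .zero => fun _ => Part.some 0
  | .succ => fun n => Part.some (n + 1)
  | .left => fun n => Part.some n.unpair.1
  | .right => fun n => Part.some n.unpair.2
  | .oracle => g
  | .pair c d => fun n => Nat.pair <$> c.eval g n <*> d.eval g n
  | .comp c d => fun n => d.eval g n >>= c.eval g
  | .prec c d => fun p =>
      let (a, n) := Nat.unpair p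
      n.rec (c.eval g a) fun y IH => do
        let i ← IH
        d.eval g (Nat.pair a (Nat.pair y i))
  | .rfind c => fun a =>
      Nat.rfind fun n => (fun m => decide (m = 0)) <$> c.eval g (Nat.pair a n)

/-- The effective (bijective) numbering of the programs. -/
def OracleCode.ofNat : ℕ → OracleCode
  | 0 => .zero
  | 1 => .succ
  | 2 => .left
  | 3 => .right
  | 4 => .oracle
  | n + 5 =>
    have h0 : n / 4 < n + 5 := by omega
    have h1 : (n / 4).unpair.1 < n + 5 := lt_of_le_of_lt (Nat.unpair_left_le _) h0
    have h2 : (n / 4).unpair.2 < n + 5 := lt_of_le_of_lt (Nat.unpair_right_le _) h0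
    match n % 4 with
    | 0 => .pair (OracleCode.ofNat (n / 4).unpair.1) (OracleCode.ofNat (n / 4).unpair.2)
    | 1 => .comp (OracleCode.ofNat (n / 4).unpair.1) (OracleCode.ofNat (n / 4).unpair.2)
    | 2 => .prec (OracleCode.ofNat (n / 4).unpair.1) (OracleCode.ofNat (n / 4).unpair.2)
    | _ => .rfind (OracleCode.ofNat (n / 4))

/-- The Turing functional `Φ_e^Z`. -/
noncomputable def Phi (e : ℕ) (Z : Set ℕ) : ℕ →. ℕ := (OracleCode.ofNat e).eval (charFun Z)

/-- `W_e^Z`, the `e`-th `Z`-c.e. set of finite binary strings: the domain of `Φ_e^Z`. -/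
def W (e : ℕ) (Z : Set ℕ) : Set (List Bool) := {ρ | (Phi e Z (Encodable.encode ρ)).Dom}

/-- The finite set `{n < |ρ| : ρ(n) = 1}` identified with the binary string `ρ`. -/
def stringSet (ρ : List Bool) : Set ℕ := {n | ρ[n]? = some true}

/-- `𝒰_e^Z = {X : ∃ ρ ⊆ X, ρ ∈ W_e^Z}`, the `e`-th upward-closed `Σ⁰₁(Z)` class. -/
def U (e : ℕ) (Z : Set ℕ) : Set (Set ℕ) := {X | ∃ ρ ∈ W e Z, stringSet ρ ⊆ X}

/-- `𝒰_C^ℳ = ⋂_{(e,i) ∈ C} 𝒰_e^{Z_i}`, where `ℳ = {Z_0, Z_1, …}`. -/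
def UInter (Z : ℕ → Set ℕ) (C : Set (ℕ × ℕ)) : Set (Set ℕ) := ⋂ p ∈ C, U p.1 (Z p.2)

/-- Large classes: closed upward, and meeting every finite cover of `ℕ`. -/
structure IsLarge (A : Set (Set ℕ)) : Prop where
  upward : ∀ X ∈ A, ∀ Y : Set ℕ, X ⊆ Y → Y ∈ A
  cover : ∀ (k : ℕ) (Y : Fin k → Set ℕ), (⋃ i, Y i) = Set.univ → ∃ i, Y i ∈ A

/-- `ℒ_X`, the class of all sets having an infinite intersection with `X`. -/
def infInter (X : Set ℕ) : Set (Set ℕ) := {Y | (Y ∩ X).Infinite}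

/-- `ℳ`-minimal large classes. -/
structure IsMinimalFor (M : Set (Set ℕ)) (A : Set (Set ℕ)) : Prop where
  large : IsLarge A
  minimal : ∀ X ∈ M, ∀ e : ℕ, A ⊆ U e X ∨ ¬ IsLarge (A ∩ U e X)

/-- `ℳ`-cohesive large classes. -/
structure IsCohesiveFor (M : Set (Set ℕ)) (A : Set (Set ℕ)) : Prop where
  large : IsLarge A
  cohesive : ∀ X ∈ M, A ⊆ infInter X ∨ A ⊆ infInter Xᶜ

end Largeness

namespace Largeness

open Filter

/-! Let F be the Fubini square of a nonprincipal ultrafilter, on columns `Nat.pair n ·`. For each i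
let D_i ∈ F be Z_i or its complement. The class of sets meeting every D_i infinitely contains F, so
it is large, and it is cohesive by the choice of the D_i. It has the form `UInter Z C` because
infinite intersection with D_i is a countable conjunction of Σ⁰₁(Z_i) conditions. Minimality fails
at `columnPairs`, a Σ⁰₁ class that also contains F: intersecting with it preserves largeness. Yet
the class is not inside it, since members of F reach arbitrarily late columns and a diagonal choice
meets all D_i infinitely with one point per column (`exists_infinite_inter_notMem_columnPairs`). -/

theorem OracleCode.ofNat_surjective : Function.Surjective OracleCode.ofNat := by
  intro c
  induction c with
  | zero => exact ⟨0, by rw [OracleCode.ofNat]⟩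
  | succ => exact ⟨1, by rw [OracleCode.ofNat]⟩
  | left => exact ⟨2, by rw [OracleCode.ofNat]⟩
  | right => exact ⟨3, by rw [OracleCode.ofNat]⟩
  | oracle => exact ⟨4, by rw [OracleCode.ofNat]⟩
  | pair c d hc hd =>
    obtain ⟨a, rfl⟩ := hc
    obtain ⟨b, rfl⟩ := hd
    refine ⟨4 * Nat.pair a b + 5, ?_⟩
    have h : 4 * Nat.pair a b % 4 = 0 := by omega
    have h' : 4 * Nat.pair a b / 4 = Nat.pair a b := by omega
    rw [OracleCode.ofNat]
    simp only [h, h', Nat.unpair_pair]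
  | comp c d hc hd =>
    obtain ⟨a, rfl⟩ := hc
    obtain ⟨b, rfl⟩ := hd
    refine ⟨(4 * Nat.pair a b + 1) + 5, ?_⟩
    have h : (4 * Nat.pair a b + 1) % 4 = 1 := by omega
    have h' : (4 * Nat.pair a b + 1) / 4 = Nat.pair a b := by omega
    rw [OracleCode.ofNat]
    simp only [h, h', Nat.unpair_pair]
  | prec c d hc hd =>
    obtain ⟨a, rfl⟩ := hc
    obtain ⟨b, rfl⟩ := hd
    refine ⟨(4 * Nat.pair a b + 2) + 5, ?_⟩
    have h : (4 * Nat.pair a b + 2) % 4 = 2 := by omega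
    have h' : (4 * Nat.pair a b + 2) / 4 = Nat.pair a b := by omega
    rw [OracleCode.ofNat]
    simp only [h, h', Nat.unpair_pair]
  | rfind c hc =>
    obtain ⟨a, rfl⟩ := hc
    refine ⟨(4 * a + 3) + 5, ?_⟩
    have h : (4 * a + 3) % 4 = 3 := by omega
    have h' : (4 * a + 3) / 4 = a := by omega
    rw [OracleCode.ofNat]
    simp only [h, h']

/-! ### Oracle programs and c.e. sets of strings -/

theorem OracleCode.eval_comp_of_eq {o : ℕ →. ℕ} {c d : OracleCode} {n a : ℕ} {b : Part ℕ}
    (hd : d.eval o n = Part.some a) (hc : c.eval o a = b) : (OracleCode.comp c d).eval o n = b := by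
  change (d.eval o n).bind (c.eval o) = b
  rw [hd]
  exact (Part.bind_some _ _).trans hc

theorem OracleCode.eval_pair_of_eq {o : ℕ →. ℕ} {c d : OracleCode} {n a b : ℕ}
    (hc : c.eval o n = Part.some a) (hd : d.eval o n = Part.some b) :
    (OracleCode.pair c d).eval o n = Part.some (Nat.pair a b) := by
  change (Nat.pair <$> c.eval o n <*> d.eval o n) = _
  rw [hc, hd]
  simp [Seq.seq]

theorem OracleCode.eval_rfind_dom_iff {o : ℕ →. ℕ} {c : OracleCode} {a : ℕ} {f : ℕ → ℕ}
    (hc : ∀ n, c.eval o (Nat.pair a n) = Part.some (f n)) :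
    ((OracleCode.rfind c).eval o a).Dom ↔ ∃ n, f n = 0 := by
  have h : (OracleCode.rfind c).eval o a =
      Nat.rfind (fun n => Part.some (decide (f n = 0))) :=
    congrArg Nat.rfind (funext fun n =>
      (congrArg (Part.map fun m => decide (m = 0)) (hc n)).trans (Part.map_some _ _))
  rw [h]
  refine Nat.rfind_dom'.trans (exists_congr fun n => ?_)
  simp

theorem OracleCode.exists_eval_of_primrec (o : ℕ →. ℕ) {f : ℕ → ℕ} (hf : Nat.Primrec f) :
    ∃ c : OracleCode, ∀ n, c.eval o n = Part.some (f n) := by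
  induction hf with
  | zero => exact ⟨.zero, fun _ => rfl⟩
  | succ => exact ⟨.succ, fun _ => rfl⟩
  | left => exact ⟨.left, fun _ => rfl⟩
  | right => exact ⟨.right, fun _ => rfl⟩
  | pair _ _ hf hg =>
    obtain ⟨c, hc⟩ := hf
    obtain ⟨d, hd⟩ := hg
    exact ⟨.pair c d, fun n => OracleCode.eval_pair_of_eq (hc n) (hd n)⟩
  | comp _ _ hf hg =>
    obtain ⟨c, hc⟩ := hf
    obtain ⟨d, hd⟩ := hg
    exact ⟨.comp c d, fun n => OracleCode.eval_comp_of_eq (hd n) (hc _)⟩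
  | prec _ _ hf hg =>
    obtain ⟨c, hc⟩ := hf
    obtain ⟨d, hd⟩ := hg
    refine ⟨.prec c d, fun p => ?_⟩
    simp only [OracleCode.eval, Nat.unpaired]
    induction p.unpair.2 with
    | zero => exact hc _
    | succ n ih => simp only [ih]; simp [hd]

/-- Searching for a witness of a primitive recursive predicate with one oracle query gives an
oracle-c.e. set of strings. -/
theorem exists_W_eq (X : Set ℕ) (P : List Bool → ℕ → ℕ → Prop)
    (hP : PrimrecPred fun q : (List Bool × ℕ) × ℕ => P q.1.1 q.1.2 q.2) :
    ∃ e, W e X = {ρ | ∃ m q, q ∈ charFun X m ∧ P ρ m q} := by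
  classical
  have hf : Primrec fun q : (List Bool × ℕ) × ℕ => if P q.1.1 q.1.2 q.2 then 0 else 1 :=
    Primrec.ite hP (Primrec.const 0) (Primrec.const 1)
  -- `Primrec` works on codes of `Option` values, where `some` adds one; the predecessor removes
  -- that shift.
  obtain ⟨c, hc⟩ := OracleCode.exists_eval_of_primrec (charFun X) (Nat.Primrec.pred.comp hf)
  obtain ⟨i, hi⟩ := OracleCode.exists_eval_of_primrec (charFun X) Nat.Primrec.id
  obtain ⟨e, he⟩ := OracleCode.ofNat_surjective
    (.rfind (.comp c (.pair i (.comp .oracle .right))))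
  refine ⟨e, Set.ext fun ρ => ?_⟩
  have horacle : ∀ m, OracleCode.oracle.eval (charFun X) m =
      Part.some (if m ∈ X then 1 else 0) := fun m => by
    simp only [OracleCode.eval, charFun]
  have key : ∀ m, (OracleCode.comp c (.pair i (.comp .oracle .right))).eval (charFun X)
      (Nat.pair (Encodable.encode ρ) m) =
      Part.some (if P ρ m (if m ∈ X then 1 else 0) then 0 else 1) := by
    intro m
    have h : Nat.pair (Nat.pair (Encodable.encode ρ) m) (if m ∈ X then 1 else 0) =
        Encodable.encode ((ρ, m), if m ∈ X then 1 else 0) := by simp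
    refine OracleCode.eval_comp_of_eq (OracleCode.eval_pair_of_eq (hi _)
      (OracleCode.eval_comp_of_eq (a := m) (by simp [OracleCode.eval]) (horacle m))) ?_
    rw [hc, id, h]
    simp only [Encodable.encodek, Option.map_some, Encodable.encode_some, Nat.pred_succ,
      Encodable.encode_nat]
  have hch : ∀ m q, q ∈ charFun X m ↔ q = if m ∈ X then 1 else 0 := fun m q => by
    simp [charFun]
  have hdom : ρ ∈ W e X ↔ ∃ m, (if P ρ m (if m ∈ X then 1 else 0) then 0 else 1) = 0 := by
    simp only [W, Phi, he]
    exact OracleCode.eval_rfind_dom_iff key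
  rw [hdom]
  simp [hch]

theorem primrecPred_getElem {α : Type*} [Primcodable α] {f : α → List Bool} {g : α → ℕ}
    (hf : Primrec f) (hg : Primrec g) : PrimrecPred fun a => (f a)[g a]? = some true :=
  Primrec.eq.comp (Primrec.list_getElem?.comp hf hg) (Primrec.const _)

/-! ### Two kinds of Σ⁰₁ classes -/

theorem exists_stringSet_eq (s : Finset ℕ) : ∃ ρ : List Bool, stringSet ρ = s := by
  refine ⟨(List.range (s.sup id + 1)).map fun n => decide (n ∈ s), ?_⟩
  ext n
  simp only [stringSet, Set.mem_ofPred_eq, List.getElem?_map, Option.map_eq_some_iff,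
    decide_eq_true_eq, Finset.mem_coe]
  constructor
  · rintro ⟨a, ha, hmem⟩
    obtain ⟨_, h⟩ := List.getElem?_eq_some_iff.1 ha
    rw [List.getElem_range] at h
    exact h ▸ hmem
  · intro h
    have hlt : n < s.sup id + 1 := Nat.lt_succ_of_le (Finset.le_sup (f := id) h)
    exact ⟨n, by simp [hlt], h⟩

/-- The bit b selects X (b = 1) or its complement (b = 0), so both are treated at once. -/
theorem exists_U_eq_inter (X : Set ℕ) (b n : ℕ) :
    ∃ e, U e X = {Y | ∃ m ∈ Y, n < m ∧ b ∈ charFun X m} := by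
  obtain ⟨e, he⟩ := exists_W_eq X (fun ρ m q => ρ[m]? = some true ∧ n < m ∧ q = b)
    ((primrecPred_getElem (Primrec.fst.comp Primrec.fst) (Primrec.snd.comp Primrec.fst)).and
      ((Primrec.nat_lt.comp (Primrec.const n) (Primrec.snd.comp Primrec.fst)).and
        (Primrec.eq.comp Primrec.snd (Primrec.const b))))
  refine ⟨e, Set.ext fun Y => ?_⟩
  simp only [U, he, Set.mem_ofPred_eq]
  constructor
  · rintro ⟨ρ, ⟨m, q, hq, hm, hn, rfl⟩, hρ⟩
    exact ⟨m, hρ hm, hn, hq⟩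
  · rintro ⟨m, hm, hn, hb⟩
    obtain ⟨ρ, hρ⟩ := exists_stringSet_eq {m}
    have hρm : m ∈ stringSet ρ := by simp [hρ]
    exact ⟨ρ, ⟨m, b, hb, hρm, hn, rfl⟩, by simpa [hρ] using hm⟩

/-- The sets containing two distinct elements of a column `{Nat.pair n m : m ∈ ℕ}`. -/
def columnPairs : Set (Set ℕ) :=
  {Y | ∃ a ∈ Y, ∃ b ∈ Y, a ≠ b ∧ a.unpair.1 = b.unpair.1}

theorem exists_U_eq_columnPairs (X : Set ℕ) : ∃ e, U e X = columnPairs := by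
  have hl : Primrec fun q : (List Bool × ℕ) × ℕ => q.1.1 := Primrec.fst.comp Primrec.fst
  have ha : Primrec fun q : (List Bool × ℕ) × ℕ => q.1.2.unpair.1 :=
    Primrec.fst.comp (Primrec.unpair.comp (Primrec.snd.comp Primrec.fst))
  have hb : Primrec fun q : (List Bool × ℕ) × ℕ => q.1.2.unpair.2 :=
    Primrec.snd.comp (Primrec.unpair.comp (Primrec.snd.comp Primrec.fst))
  obtain ⟨e, he⟩ := exists_W_eq X
    (fun ρ m _ => ρ[m.unpair.1]? = some true ∧ ρ[m.unpair.2]? = some true ∧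
      ¬ m.unpair.1 = m.unpair.2 ∧ m.unpair.1.unpair.1 = m.unpair.2.unpair.1)
    ((primrecPred_getElem hl ha).and ((primrecPred_getElem hl hb).and
      ((Primrec.eq.comp ha hb).not.and (Primrec.eq.comp
        (Primrec.fst.comp (Primrec.unpair.comp ha)) (Primrec.fst.comp (Primrec.unpair.comp hb))))))
  refine ⟨e, Set.ext fun Y => ?_⟩
  simp only [U, he, Set.mem_ofPred_eq, columnPairs]
  constructor
  · rintro ⟨ρ, ⟨m, q, -, h1, h2, h3, h4⟩, hρ⟩
    exact ⟨_, hρ h1, _, hρ h2, h3, h4⟩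
  · rintro ⟨a, ha, b, hb, hne, hab⟩
    obtain ⟨ρ, hρ⟩ := exists_stringSet_eq {a, b}
    have hρa : a ∈ stringSet ρ := by simp [hρ]
    have hρb : b ∈ stringSet ρ := by simp [hρ]
    -- One search variable codes both points; the oracle's answer is ignored.
    refine ⟨ρ, ⟨Nat.pair a b, _, Part.mem_some _, ?_⟩, ?_⟩
    · simp only [Nat.unpair_pair]
      exact ⟨hρa, hρb, hne, hab⟩
    · rw [hρ]
      simp [Set.insert_subset_iff, ha, hb]

/-! ### The Fubini ultrafilter and diagonalization -/

/-- The Fubini square of the hyperfilter on `ℕ`, transported along `Nat.pair`. -/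
noncomputable def fubini : Ultrafilter ℕ :=
  (hyperfilter ℕ).bind fun n => (hyperfilter ℕ).map (Nat.pair n)

theorem mem_fubini {X : Set ℕ} :
    X ∈ fubini ↔ ∀ᶠ n in (hyperfilter ℕ : Filter ℕ), ∀ᶠ m in (hyperfilter ℕ : Filter ℕ),
      Nat.pair n m ∈ X :=
  Iff.rfl

theorem exists_unpair_gt_of_mem_fubini {X : Set ℕ} (hX : X ∈ fubini) (k : ℕ) :
    ∃ a ∈ X, k < a.unpair.1 := by
  obtain ⟨n, hn, hk⟩ := ((mem_fubini.1 hX).and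
    (Nat.hyperfilter_le_atTop (eventually_gt_atTop k))).exists
  obtain ⟨m, hm⟩ := hn.exists
  exact ⟨_, hm, by simpa using hk⟩

theorem infinite_of_mem_fubini {X : Set ℕ} (hX : X ∈ fubini) : X.Infinite := by
  refine Set.infinite_of_forall_exists_gt fun k => ?_
  obtain ⟨a, ha, hk⟩ := exists_unpair_gt_of_mem_fubini hX k
  exact ⟨a, ha, hk.trans_le (Nat.unpair_left_le a)⟩

theorem mem_columnPairs_of_mem_fubini {X : Set ℕ} (hX : X ∈ fubini) : X ∈ columnPairs := by
  obtain ⟨n, hn⟩ := (mem_fubini.1 hX).exists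
  obtain ⟨m, hm⟩ := hn.exists
  obtain ⟨m', hm', hlt⟩ := (hn.and (Nat.hyperfilter_le_atTop (eventually_gt_atTop m))).exists
  exact ⟨_, hm, _, hm', by simp [Nat.pair_eq_pair, (ne_of_lt hlt)], by simp⟩

theorem isLarge_of_ultrafilter {F : Ultrafilter ℕ} {A : Set (Set ℕ)}
    (hup : ∀ X ∈ A, ∀ Y : Set ℕ, X ⊆ Y → Y ∈ A) (hF : ∀ X ∈ F, X ∈ A) : IsLarge A := by
  refine ⟨hup, fun k Y hY => ?_⟩
  have h : (⋃ i ∈ (Set.univ : Set (Fin k)), Y i) ∈ F := by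
    simp only [Set.mem_univ, Set.iUnion_true, hY]
    exact univ_mem
  obtain ⟨i, -, hi⟩ := (Ultrafilter.finite_biUnion_mem_iff Set.finite_univ).1 h
  exact ⟨i, hF _ hi⟩

/-- Countably many members of `fubini` all have infinite intersection with a single set that
meets every column in at most one point. -/
theorem exists_infinite_inter_notMem_columnPairs {D : ℕ → Set ℕ} (hD : ∀ i, D i ∈ fubini) :
    ∃ Y : Set ℕ, (∀ i, (Y ∩ D i).Infinite) ∧ Y ∉ columnPairs := by
  have hmem : ∀ k, (⋂ i ∈ Set.Iic k, D i) ∈ (fubini : Filter ℕ) := fun k =>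
    (biInter_mem (Set.finite_Iic k)).2 fun i _ => hD i
  choose g hg hlt using fun k => exists_unpair_gt_of_mem_fubini (hmem k)
  -- Each new point lies in all D_i with i ≤ k + 1 and in a column strictly beyond that of the
  -- previous point.
  let y : ℕ → ℕ := fun k => k.rec (g 0 0) fun k a => g (k + 1) a.unpair.1
  have hyD : ∀ i k, i ≤ k → y k ∈ D i := by
    intro i k hik
    cases k with
    | zero => exact Set.mem_iInter₂.1 (hg 0 0) i hik
    | succ k => exact Set.mem_iInter₂.1 (hg (k + 1) (y k).unpair.1) i hik
  have hmono : StrictMono fun k => (y k).unpair.1 := strictMono_nat_of_lt_succ fun k => hlt _ _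
  have hinj : Function.Injective y := fun a b h => hmono.injective (congrArg (·.unpair.1) h)
  refine ⟨Set.range y, fun i => ?_, ?_⟩
  · refine ((Set.Ici_infinite i).image hinj.injOn).mono ?_
    rintro _ ⟨k, hk, rfl⟩
    exact ⟨⟨k, rfl⟩, hyD i k hk⟩
  · rintro ⟨_, ⟨a, rfl⟩, _, ⟨b, rfl⟩, hne, hab⟩
    exact hne (congrArg y (hmono.injective hab))

theorem exists_UInter_eq_iInter_infInter (Z D : ℕ → Set ℕ) (hD : ∀ i, D i = Z i ∨ D i = (Z i)ᶜ) :
    ∃ C, UInter Z C = ⋂ i, infInter (D i) := by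
  -- With the largest admissible C, only the inclusion of `UInter Z C` in the intersection needs
  -- work.
  refine ⟨{p | ⋂ i, infInter (D i) ⊆ U p.1 (Z p.2)}, subset_antisymm ?_ ?_⟩
  · intro Y hY
    refine Set.mem_iInter.2 fun i => Set.infinite_of_forall_exists_gt fun n => ?_
    obtain ⟨b, hb⟩ : ∃ b, ∀ m, b ∈ charFun (Z i) m ↔ m ∈ D i := by
      rcases hD i with h | h
      · exact ⟨1, fun m => by simp [charFun, h]⟩
      · exact ⟨0, fun m => by simp [charFun, h]⟩
    obtain ⟨e, he⟩ := exists_U_eq_inter (Z i) b n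
    have hmem : (e, i) ∈ {p : ℕ × ℕ | ⋂ i, infInter (D i) ⊆ U p.1 (Z p.2)} := by
      intro T hT
      obtain ⟨m, hm, hnm⟩ := (Set.mem_iInter.1 hT i).exists_gt n
      exact he ▸ ⟨m, hm.1, hnm, (hb m).2 hm.2⟩
    have hYe : Y ∈ U e (Z i) := Set.mem_iInter₂.1 hY (e, i) hmem
    rw [he] at hYe
    obtain ⟨m, hm, hnm, hbm⟩ := hYe
    exact ⟨m, ⟨hm, (hb m).1 hbm⟩, hnm⟩
  · exact Set.subset_iInter₂ fun p hp => hp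

end Largeness

open Largeness in
theorem mainTheorem10 (M : Set (Set ℕ)) (hM : Largeness.IsTuringIdeal M)
    (Z : ℕ → Set ℕ) (hZ : Set.range Z = M) :
    ∃ C : Set (ℕ × ℕ),
      Largeness.IsCohesiveFor M (Largeness.UInter Z C) ∧
        ¬ Largeness.IsMinimalFor M (Largeness.UInter Z C) := by
  have hex : ∀ i, ∃ D ∈ fubini, D = Z i ∨ D = (Z i)ᶜ := fun i =>
    (fubini.mem_or_compl_mem (Z i)).elim (fun h => ⟨_, h, .inl rfl⟩) (fun h => ⟨_, h, .inr rfl⟩)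
  choose D hDF hDZ using hex
  obtain ⟨C, hC⟩ := exists_UInter_eq_iInter_infInter Z D hDZ
  have hup : ∀ X ∈ ⋂ i, infInter (D i), ∀ Y : Set ℕ, X ⊆ Y → Y ∈ ⋂ i, infInter (D i) :=
    fun X hX Y hXY => Set.mem_iInter.2 fun i =>
      (Set.mem_iInter.1 hX i).mono (Set.inter_subset_inter_left _ hXY)
  have hsub : ∀ X ∈ fubini, X ∈ ⋂ i, infInter (D i) := fun X hX =>
    Set.mem_iInter.2 fun i => infinite_of_mem_fubini (Filter.inter_mem hX (hDF i))
  refine ⟨C, ?_, ?_⟩ <;> rw [hC]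
  · refine ⟨isLarge_of_ultrafilter hup hsub, ?_⟩
    rw [← hZ]
    rintro _ ⟨i, rfl⟩
    rcases hDZ i with h | h
    · exact .inl (h ▸ Set.iInter_subset _ i)
    · exact .inr (h ▸ Set.iInter_subset _ i)
  · intro hmin
    obtain ⟨e, he⟩ := exists_U_eq_columnPairs (Z 0)
    rcases hmin.minimal (Z 0) (hZ ▸ Set.mem_range_self 0) e with h | h <;> rw [he] at h
    · obtain ⟨Y, hY, hYc⟩ := exists_infinite_inter_notMem_columnPairs hDF
      exact hYc (h (Set.mem_iInter.2 hY))
    · refine h (isLarge_of_ultrafilter (F := fubini) ?_ fun X hX =>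
        ⟨hsub X hX, mem_columnPairs_of_mem_fubini hX⟩)
      rintro X ⟨hX, a, ha, b, hb, hab⟩ Y hXY
      exact ⟨hup X hX Y hXY, a, hXY ha, b, hXY hb, hab⟩
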